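/- Let $X$ be a Euclidean space (a finite-dimensional real inner product space). For a nonempty set $D\subseteq X$ let $d_D(x)=\inf_{c\in D}\|x-c\|$, let $P_Dx=\{c\in D:\|x-c\|=d_D(x)\}$ be the (set-valued) projector, and for $\lambda\ge 0$ let $P_D^\lambda x=\{(1-\lambda)x+\lambda p: p\in P_Dx\}$. For $x\in D$, the proximal normal cone is $N^{\mathrm{prox}}_D(x)=\{t(z-x): t\ge 0,\ x\in P_Dz\}$, and the limiting normal cone $N_D(x)$ is the set of all $u$ for which there are $x_n\to x$, $u_n\to u$ with $x_n\in D$ and $u_n\in N^{\mathrm{prox}}_D(x_n)$. Let $\bar B(w;\delta)$ denote the closed ball with center $w$ and radius $\delta$. A set $D$ is *superregular* at $w\in D$ if for every $\varepsilon>0$ there is $\delta>0$ such that $\langle u,x-y\rangle\ge-\varepsilon\|u\|\|x-y\|$ for all $x,y\in D\cap \bar B(w;\delta)$ and all $u\in N^{\mathrm{prox}}_D(x)$. A finite system $\{D_i\}_{i\in K}$ of sets with a common point $w$ is *linearly regular around* $w$ if there are $\delta,\kappa>0$ with $d_{\bigcap_{i\in K} D_i}(x)\le\kappa\max_{i\in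 K} d_{D_i}(x)$ for all $x\in \bar B(w;\delta)$; it is *strongly regular at* $w$ if $\sum_{i\in K} u_i=0$ and $u_i\in N_{D_i}(w)$ for all $i\in K$ imply $u_i=0$ for all $i\in K$. Let $m,\ell$ be positive integers, $I=\{1,\dots,m\}$, $J=\{1,\dots,\ell\}$, let $\{C_i\}_{i\in I}$ be closed subsets of $X$, let $C:=\bigcap_{i\in I}C_i$, and let $w\in C$. For every $j\in J$ let $\lambda_j,\mu_j\in\,]0,2]$, put $$\widehat\beta_j:=\Big(\frac{\lambda_j}{2-\lambda_j}+\frac{\mu_j}{2-\mu_j}\Big)^{-1},\qquad\text{with } \widehat\beta_j:=0 \text{ if } \lambda_j=2 \text{ or } \mu_j=2,$$ let $\alpha_j\in\,]0,1+\widehat\beta_j[$, and let $s_j,t_j\in I$ with $s_j\ne t_j$ and $\{s_j\}_{j\in J}\cup\{t_j\}_{j\in J}=I$. Set $T_j:=(1-\alpha_j)\mathrm{Id}+\alpha_jP_{C_{t_j}}^{\mu_j}P_{C_{s_j}}^{\lambda_j}$ (set-valued). The cyclic generalized Douglas--Rachford (gDR) algorithm generates sequences $(x_n)_{n\in\mathbb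 N}$ from a point $x_0\in X$ by $x_{n+1}\in T_{n+1}x_n$ for all $n\ge 0$, where $T_{\ell n+j}:=T_j$ for $n\in\mathbb N$ and $j\in J$. **Corollary 5.10.** Suppose that every $C_i$ is superregular at $w$, that $\{C_i\}_{i\in I}$ is linearly regular around $w$, and that for every $j\in J$ the pair $\{C_{s_j},C_{t_j}\}$ is linearly regular around $w$ if $\min\{\lambda_j,\mu_j\}<2$ and strongly regular at $w$ otherwise. Then the cyclic gDR algorithm converges $R$-linearly locally to a point of $C$: there exist $\rho\in[0,1[$ and $r>0$ such that for every sequence $(x_n)_{n\in\mathbb N}$ generated by the cyclic gDR algorithm with $\|x_0-w\|\le r$, there exist $\overline x\in C$ and $\sigma\ge 0$ with $\|x_n-\overline x\|\le\sigma\rho^n$ for all $n\in\mathbb N$. -/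

import Mathlib

open Filter Topology

noncomputable section

namespace GDR

variable {X : Type*} [NormedAddCommGroup X] [InnerProductSpace ℝ X]

/-- The set-valued projector `P_C x`, i.e. the set of `c ∈ C` with `‖x - c‖ = d_C(x)`. -/
def proj (C : Set X) (x : X) : Set X :=
  {c | c ∈ C ∧ ‖x - c‖ = Metric.infDist x C}

/-- The relaxed projector `P_C^lam = (1 - lam) Id + lam P_C` (set-valued). -/
def relaxedProj (C : Set X) (lam : ℝ) (x : X) : Set X :=
  {r | ∃ p ∈ proj C x, r = (1 - lam) • x + lam • p}

/-- The generalized Douglas-Rachford operator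
`(1 - alpha) Id + alpha P_B^mu P_A^lam` for the pair `(A, B)` (set-valued). -/
def gDR (A B : Set X) (lam mu alpha : ℝ) (x : X) : Set X :=
  {y | ∃ r ∈ relaxedProj A lam x, ∃ z ∈ relaxedProj B mu r,
    y = (1 - alpha) • x + alpha • z}

/-- The proximal normal cone to `C` at `x`: all `t (z - x)` with `t ≥ 0` and `x ∈ P_C z`. -/
def proxNormalCone (C : Set X) (x : X) : Set X :=
  {u | ∃ z : X, ∃ t : ℝ, x ∈ proj C z ∧ 0 ≤ t ∧ u = t • (z - x)}

/-- The limiting normal cone to `C` at `x`. -/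
def limitingNormalCone (C : Set X) (x : X) : Set X :=
  {u | ∃ xs us : ℕ → X, Tendsto xs atTop (𝓝 x) ∧ Tendsto us atTop (𝓝 u) ∧
    ∀ n, xs n ∈ C ∧ us n ∈ proxNormalCone C (xs n)}

/-- `(eps, delta)`-regularity of `C` at `w`. -/
def IsRegularAt (C : Set X) (eps delta : ℝ) (w : X) : Prop :=
  ∀ x ∈ C ∩ Metric.closedBall w delta, ∀ y ∈ C ∩ Metric.closedBall w delta,
    ∀ u ∈ proxNormalCone C x, -eps * ‖u‖ * ‖x - y‖ ≤ inner ℝ u (x - y)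

/-- Superregularity of `C` at `w`. -/
def IsSuperregularAt (C : Set X) (w : X) : Prop :=
  ∀ eps : ℝ, 0 < eps → ∃ delta : ℝ, 0 < delta ∧ IsRegularAt C eps delta w

/-- `kappa`-linear regularity on `U` of a nonempty finite system of sets with common points
(the supremum is then the maximum of finitely many real numbers). -/
def IsLinearlyRegularOn {ι : Type*} (C : ι → Set X) (kappa : ℝ) (U : Set X) : Prop :=
  ∀ x ∈ U, Metric.infDist x (⋂ i, C i) ≤ kappa * ⨆ i, Metric.infDist x (C i)

/-- Linear regularity of a system of sets around `w`. -/
def IsLinearlyRegularAround {ι : Type*} (C : ι → Set X) (w : X) : Prop :=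
  ∃ delta : ℝ, 0 < delta ∧ ∃ kappa : ℝ, 0 < kappa ∧
    IsLinearlyRegularOn C kappa (Metric.closedBall w delta)

/-- Strong regularity of a finite system of sets at a common point `w`. -/
def IsStronglyRegularAt {ι : Type*} [Fintype ι] (C : ι → Set X) (w : X) : Prop :=
  ∀ u : ι → X, (∀ i, u i ∈ limitingNormalCone (C i) w) → ∑ i, u i = 0 → ∀ i, u i = 0

/-- The number `(lam / (2 - lam) + mu / (2 - mu))⁻¹` for `lam, mu ∈ ]0, 2]`, with the
convention that it is `0` as soon as `lam = 2` or `mu = 2`. -/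
def betaHat (lam mu : ℝ) : ℝ :=
  if lam = 2 ∨ mu = 2 then 0 else (lam / (2 - lam) + mu / (2 - mu))⁻¹

/-- `x` is a cyclic sequence for `T 0, …, T (l - 1)`: the step from `x n` to `x (n + 1)` uses the
operator with index `n` modulo `l`. -/
def IsCyclicSequence {l : ℕ} (hl : 0 < l) (T : Fin l → X → Set X) (x : ℕ → X) : Prop :=
  ∀ n : ℕ, x (n + 1) ∈ T ⟨n % l, Nat.mod_lt n hl⟩ (x n)

/-- The sequence `x` converges to `xbar` with R-linear rate `rho ∈ [0, 1[`. -/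
def ConvergesRLinearly (x : ℕ → X) (xbar : X) (rho : ℝ) : Prop :=
  0 ≤ rho ∧ rho < 1 ∧ ∃ sigma : ℝ, 0 ≤ sigma ∧ ∀ n : ℕ, ‖x n - xbar‖ ≤ sigma * rho ^ n

end GDR

end

/-! Near `w`, superregularity makes each relaxed projector quasi-nonexpansive up to a factor `1 +
eps`, with a decrease in the squared displacement. Composing two of them and averaging, each gDR
step from `x` to `y` has `‖y - c‖²` at most `(1 + eps)‖x - c‖² - eta‖x - y‖²` for `c` in both sets
(`exists_norm_gDR_sub_sq_le`). Regularity of the pair gives coercivity: `‖x - y‖` dominates the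
distance from `x` to either set. Here `eta` and `nu` do not depend on `eps`.

Over a cycle these estimates telescope. Every `C i` is used at some step, so its distance from the
start is controlled by the displacements in the cycle; linear regularity of the whole system then
bounds the squared distance to `C` by a multiple of the sum of squared displacements. For small
`eps` the accumulated decrease beats the factor `(1 + eps) ^ l`, and the distance to `C` contracts
(`exists_cycle_contraction`). Displacements within a cycle are bounded by that distance, so they
form a geometric series: the iterates stay near `w` and converge R-linearly. -/

namespace GDR

/-! ### Estimates for a single gDR step -/

section Step

variable {X : Type*} [NormedAddCommGroup X] [InnerProductSpace ℝ X]

/-- A weighted Cauchy-Schwarz inequality. It merges the decreases of the two projections into one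
for the composition, which is what allows `alpha` up to `1 + betaHat`. -/
theorem betaHat_mul_norm_add_sq_le {lam mu : ℝ} (hlam : 0 < lam ∧ lam ≤ 2)
    (hmu : 0 < mu ∧ mu ≤ 2) {E : Type*} [NormedAddCommGroup E] (a b : E) :
    betaHat lam mu * ‖a + b‖ ^ 2 ≤
      (2 - lam) / lam * ‖a‖ ^ 2 + (2 - mu) / mu * ‖b‖ ^ 2 := by
  obtain ⟨hl0, hl2⟩ := hlam
  obtain ⟨hm0, hm2⟩ := hmu
  have hA : 0 ≤ (2 - lam) / lam := div_nonneg (by linarith) hl0.le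
  have hB : 0 ≤ (2 - mu) / mu := div_nonneg (by linarith) hm0.le
  unfold betaHat
  split_ifs with h
  · rw [zero_mul]
    positivity
  · push Not at h
    have hl3 : 0 < 2 - lam := sub_pos.2 (lt_of_le_of_ne hl2 h.1)
    have hm3 : 0 < 2 - mu := sub_pos.2 (lt_of_le_of_ne hm2 h.2)
    have hL : 0 < lam / (2 - lam) := by positivity
    have hM : 0 < mu / (2 - mu) := by positivity
    rw [← inv_div lam (2 - lam), ← inv_div mu (2 - mu)]
    generalize lam / (2 - lam) = L at hL
    generalize mu / (2 - mu) = M at hM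
    have hn : ‖a + b‖ ^ 2 ≤ (‖a‖ + ‖b‖) ^ 2 := by gcongr; exact norm_add_le a b
    have key : L⁻¹ * ‖a‖ ^ 2 + M⁻¹ * ‖b‖ ^ 2 - (L + M)⁻¹ * (‖a‖ + ‖b‖) ^ 2
        = (M * ‖a‖ - L * ‖b‖) ^ 2 / (L * M * (L + M)) := by
      field_simp
      ring
    have h1 : 0 ≤ (M * ‖a‖ - L * ‖b‖) ^ 2 / (L * M * (L + M)) := by positivity
    have h2 : (L + M)⁻¹ * ‖a + b‖ ^ 2 ≤ (L + M)⁻¹ * (‖a‖ + ‖b‖) ^ 2 := by gcongr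
    linarith

/-- The identity holds for every real `alpha`, so it also covers over-relaxation. -/
theorem norm_sq_lineMap_sub (alpha : ℝ) (x z c : X) :
    ‖(1 - alpha) • x + alpha • z - c‖ ^ 2 =
      (1 - alpha) * ‖x - c‖ ^ 2 + alpha * ‖z - c‖ ^ 2 - alpha * (1 - alpha) * ‖x - z‖ ^ 2 := by
  have h1 : (1 - alpha) • x + alpha • z - c = (1 - alpha) • (x - c) + alpha • (z - c) := by
    module
  have h2 : x - z = (x - c) - (z - c) := by abel
  rw [h1, h2, norm_add_sq_real, norm_sub_sq_real (x - c) (z - c), norm_smul, norm_smul,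
    inner_smul_left, inner_smul_right, mul_pow, mul_pow, Real.norm_eq_abs, Real.norm_eq_abs,
    sq_abs, sq_abs]
  simp only [conj_trivial]
  ring

theorem norm_sub_le_of_mem_proj {E : Type*} [NormedAddCommGroup E] {A : Set E} {x p c : E}
    (hp : p ∈ proj A x) (hc : c ∈ A) :
    ‖x - p‖ ≤ ‖x - c‖ := by
  rw [hp.2, ← dist_eq_norm]
  exact Metric.infDist_le_dist_of_mem hc

theorem norm_sub_eq_of_mem_relaxedProj {A : Set X} {lam : ℝ} (hlam : 0 < lam) {x r : X}
    (hr : r ∈ relaxedProj A lam x) : ‖x - r‖ = lam * Metric.infDist x A := by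
  obtain ⟨p, hp, rfl⟩ := hr
  have : x - ((1 - lam) • x + lam • p) = lam • (x - p) := by module
  rw [this, norm_smul, Real.norm_of_nonneg hlam.le, hp.2]

/-- Relaxed projectors onto regular sets are almost quasi-nonexpansive. -/
theorem IsRegularAt.norm_relaxedProj_sub_sq_le {A : Set X} {eps delta lam : ℝ} {w x r c : X}
    (hA : IsRegularAt A eps delta w) (heps : 0 ≤ eps) (hlam : 0 < lam ∧ lam ≤ 2)
    (hw : w ∈ A) (hc : c ∈ A) (hcw : ‖c - w‖ ≤ delta) (hxw : 2 * ‖x - w‖ ≤ delta)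
    (hr : r ∈ relaxedProj A lam x) :
    ‖r - c‖ ^ 2 ≤ (1 + 8 * eps) * ‖x - c‖ ^ 2 - (2 - lam) / lam * ‖x - r‖ ^ 2 := by
  obtain ⟨p, hp, rfl⟩ := hr
  have hpx : ‖x - p‖ ≤ ‖x - c‖ := norm_sub_le_of_mem_proj hp hc
  have hpw : ‖p - w‖ ≤ delta := by
    have h1 := norm_sub_le_of_mem_proj hp hw
    have h2 := norm_sub_le_norm_sub_add_norm_sub p x w
    rw [norm_sub_rev p x] at h2
    linarith
  have hpc : ‖p - c‖ ≤ 2 * ‖x - c‖ := by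
    have h2 := norm_sub_le_norm_sub_add_norm_sub p x c
    rw [norm_sub_rev p x] at h2
    linarith
  have hin := hA p ⟨hp.1, by simpa [dist_eq_norm] using hpw⟩ c
    ⟨hc, by simpa [dist_eq_norm] using hcw⟩ (x - p) ⟨x, 1, hp, zero_le_one, by simp⟩
  have hin2 : -(2 * eps) * ‖x - c‖ ^ 2 ≤ inner ℝ (x - p) (p - c) := by
    have : ‖x - p‖ * ‖p - c‖ ≤ ‖x - c‖ * (2 * ‖x - c‖) := by gcongr
    nlinarith
  have hsq : ‖x - c‖ ^ 2 = ‖x - p‖ ^ 2 + 2 * inner ℝ (x - p) (p - c) + ‖p - c‖ ^ 2 := by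
    rw [← norm_add_sq_real, sub_add_sub_cancel]
  have hxr : x - ((1 - lam) • x + lam • p) = lam • (x - p) := by module
  rw [norm_sq_lineMap_sub, hxr, norm_smul, mul_pow, Real.norm_eq_abs, sq_abs]
  have h3 : (2 - lam) / lam * (lam ^ 2 * ‖x - p‖ ^ 2) = (2 - lam) * lam * ‖x - p‖ ^ 2 := by
    have := hlam.1.ne'
    field_simp
  rw [h3]
  -- The inner product enters the expansion with factor `2 * lam ≤ 4`, turning the error `2 * eps`
  -- into `8 * eps`.
  have h4 : lam * (-(2 * eps) * ‖x - c‖ ^ 2) ≤ lam * inner ℝ (x - p) (p - c) :=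
    mul_le_mul_of_nonneg_left hin2 hlam.1.le
  have h5 : lam * (eps * ‖x - c‖ ^ 2) ≤ 2 * (eps * ‖x - c‖ ^ 2) :=
    mul_le_mul_of_nonneg_right hlam.2 (by positivity)
  nlinarith

/-- The composition of two relaxed projectors is almost quasi-nonexpansive near a point of
superregularity. -/
theorem exists_norm_relaxedProj_comp_sub_sq_le {A B : Set X} {w : X} {lam mu : ℝ}
    (hA : IsSuperregularAt A w) (hB : IsSuperregularAt B w) (hwA : w ∈ A) (hwB : w ∈ B)
    (hlam : 0 < lam ∧ lam ≤ 2) (hmu : 0 < mu ∧ mu ≤ 2) {eps : ℝ} (heps : 0 < eps) :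
    ∃ delta > 0, ∀ x r z : X, ‖x - w‖ ≤ delta → r ∈ relaxedProj A lam x →
      z ∈ relaxedProj B mu r → ∀ c ∈ A ∩ B, ‖c - w‖ ≤ 2 * delta →
      ‖z - c‖ ^ 2 ≤ (1 + eps) * ‖x - c‖ ^ 2 - (2 - lam) / lam * ‖x - r‖ ^ 2
        - (2 - mu) / mu * ‖r - z‖ ^ 2 := by
  obtain ⟨e, he, he1⟩ : ∃ e : ℝ, 0 < e ∧ (1 + 8 * e) * (1 + 8 * e) ≤ 1 + eps := by
    refine ⟨min 1 eps / 80, by positivity, ?_⟩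
    have h1 : min 1 eps ≤ 1 := min_le_left _ _
    have h2 : min 1 eps ≤ eps := min_le_right _ _
    have h3 : 0 < min 1 eps := by positivity
    nlinarith
  obtain ⟨d1, hd1, hA⟩ := hA e he
  obtain ⟨d2, hd2, hB⟩ := hB e he
  -- The intermediate point `r` lies within `3 * d` of `w`, and the one-set estimate needs twice
  -- that radius.
  obtain ⟨d, hd, hdd1, hdd2⟩ : ∃ d > 0, 6 * d ≤ d1 ∧ 6 * d ≤ d2 :=
    ⟨min d1 d2 / 6, by positivity, by linarith [min_le_left d1 d2],
      by linarith [min_le_right d1 d2]⟩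
  refine ⟨d, hd, fun x r z hx hr hz c hc hcw => ?_⟩
  have h1 := hA.norm_relaxedProj_sub_sq_le he.le hlam hwA hc.1 (by linarith) (by linarith) hr
  have hxr : ‖x - r‖ ≤ 2 * ‖x - w‖ := by
    rw [norm_sub_eq_of_mem_relaxedProj hlam.1 hr, ← dist_eq_norm x w]
    exact mul_le_mul hlam.2 (Metric.infDist_le_dist_of_mem hwA) Metric.infDist_nonneg (by norm_num)
  have hrw : ‖r - w‖ ≤ 3 * d := by
    have h2 := norm_sub_le_norm_sub_add_norm_sub r x w
    rw [norm_sub_rev r x] at h2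
    linarith
  have h2 := hB.norm_relaxedProj_sub_sq_le he.le hmu hwB hc.2 (by linarith) (by linarith) hz
  have h3 : 0 ≤ (2 - lam) / lam * ‖x - r‖ ^ 2 :=
    mul_nonneg (div_nonneg (by linarith [hlam.2]) hlam.1.le) (sq_nonneg _)
  have h4 : (1 + 8 * e) * ‖r - c‖ ^ 2 ≤
      (1 + 8 * e) * ((1 + 8 * e) * ‖x - c‖ ^ 2 - (2 - lam) / lam * ‖x - r‖ ^ 2) :=
    mul_le_mul_of_nonneg_left h1 (by positivity)
  have h5 : (1 + 8 * e) * (1 + 8 * e) * ‖x - c‖ ^ 2 ≤ (1 + eps) * ‖x - c‖ ^ 2 :=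
    mul_le_mul_of_nonneg_right he1 (sq_nonneg _)
  have h6 : 0 ≤ 8 * e * ((2 - lam) / lam * ‖x - r‖ ^ 2) := mul_nonneg (by positivity) h3
  linarith

/-- Generalized Douglas-Rachford operators are quasi firmly Fejér monotone near a point of
superregularity. -/
theorem exists_norm_gDR_sub_sq_le {A B : Set X} {w : X} {lam mu alpha : ℝ}
    (hA : IsSuperregularAt A w) (hB : IsSuperregularAt B w) (hwA : w ∈ A) (hwB : w ∈ B)
    (hlam : 0 < lam ∧ lam ≤ 2) (hmu : 0 < mu ∧ mu ≤ 2) (halpha : 0 < alpha)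
    {eps : ℝ} (heps : 0 < eps) :
    ∃ delta > 0, ∀ x y : X, ‖x - w‖ ≤ delta → y ∈ gDR A B lam mu alpha x →
      ∀ c ∈ A ∩ B, ‖c - w‖ ≤ 2 * delta →
      ‖y - c‖ ^ 2 ≤ (1 + eps) * ‖x - c‖ ^ 2
        - (1 + betaHat lam mu - alpha) / alpha * ‖x - y‖ ^ 2 := by
  obtain ⟨d, hd, H⟩ := exists_norm_relaxedProj_comp_sub_sq_le hA hB hwA hwB hlam hmu
    (div_pos heps halpha)
  refine ⟨d, hd, ?_⟩
  rintro x y hx ⟨r, hr, z, hz, rfl⟩ c hc hcw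
  have h1 := H x r z hx hr hz c hc hcw
  have h2 := betaHat_mul_norm_add_sq_le hlam hmu (x - r) (r - z)
  rw [sub_add_sub_cancel] at h2
  have hxy : x - ((1 - alpha) • x + alpha • z) = alpha • (x - z) := by module
  rw [norm_sq_lineMap_sub, hxy, norm_smul, mul_pow, Real.norm_eq_abs, sq_abs]
  have h3 : (1 + betaHat lam mu - alpha) / alpha * (alpha ^ 2 * ‖x - z‖ ^ 2)
      = (1 + betaHat lam mu - alpha) * alpha * ‖x - z‖ ^ 2 := by
    field_simp
  rw [h3]
  have h4 : alpha * ‖z - c‖ ^ 2 ≤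
      alpha * ((1 + eps / alpha) * ‖x - c‖ ^ 2 - betaHat lam mu * ‖x - z‖ ^ 2) :=
    mul_le_mul_of_nonneg_left (by linarith) halpha.le
  have h5 : alpha * ((1 + eps / alpha) * ‖x - c‖ ^ 2 - betaHat lam mu * ‖x - z‖ ^ 2)
      = (alpha + eps) * ‖x - c‖ ^ 2 - alpha * betaHat lam mu * ‖x - z‖ ^ 2 := by
    field_simp
  nlinarith

/-! ### Coercivity of a single gDR step -/

theorem infDist_le_of_mem_relaxedProj {A B : Set X} {lam mu : ℝ} (hlam : 0 < lam) (hmu : 0 < mu)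
    {x r z : X} (hr : r ∈ relaxedProj A lam x) (hz : z ∈ relaxedProj B mu r) :
    Metric.infDist x A = ‖x - r‖ / lam ∧ Metric.infDist x B ≤ ‖x - r‖ + ‖r - z‖ / mu := by
  have h1 := norm_sub_eq_of_mem_relaxedProj hlam hr
  have h2 := norm_sub_eq_of_mem_relaxedProj hmu hz
  constructor
  · rw [h1]
    field_simp
  · have h3 : Metric.infDist x B ≤ Metric.infDist r B + dist x r :=
      Metric.infDist_le_infDist_add_dist
    rw [dist_eq_norm] at h3
    rw [h2, mul_div_cancel_left₀ _ hmu.ne']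
    linarith

theorem smul_mem_proxNormalCone {A : Set X} {x u : X} (hu : u ∈ proxNormalCone A x) {t : ℝ}
    (ht : 0 ≤ t) : t • u ∈ proxNormalCone A x := by
  obtain ⟨z, s, hz, hs, rfl⟩ := hu
  exact ⟨z, t * s, hz, mul_nonneg ht hs, smul_smul _ _ _⟩

/-- Strong regularity of a pair gives a uniform lower bound for sums of nearby proximal normals. -/
theorem IsStronglyRegularAt.exists_mul_le_norm_add [FiniteDimensional ℝ X] {A B : Set X} {w : X}
    (h : IsStronglyRegularAt ![A, B] w) :
    ∃ nu > 0, ∃ delta > 0, ∀ p ∈ A, ∀ q ∈ B, ‖p - w‖ ≤ delta → ‖q - w‖ ≤ delta →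
      ∀ u ∈ proxNormalCone A p, ∀ v ∈ proxNormalCone B q, nu * (‖u‖ + ‖v‖) ≤ ‖u + v‖ := by
  by_contra! hcon
  choose p hpA q hqB hp hq u hu v hv huv using fun n : ℕ =>
    hcon (1 / ((n : ℝ) + 1)) Nat.one_div_pos_of_nat (1 / ((n : ℝ) + 1)) Nat.one_div_pos_of_nat
  have hpos : ∀ n, 0 < ‖u n‖ + ‖v n‖ := fun n => by
    by_contra! h0
    have h1 : 1 / ((n : ℝ) + 1) * (‖u n‖ + ‖v n‖) ≤ ‖u n + v n‖ := by
      have h2 : ‖u n‖ + ‖v n‖ = 0 := le_antisymm h0 (by positivity)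
      rw [h2, mul_zero]
      exact norm_nonneg _
    exact absurd (huv n) (not_lt.2 h1)
  -- Normalized so that the norms add up to 1: a cluster point is then a nonzero pair of limiting
  -- normals with zero sum.
  set a : ℕ → X := fun n => (‖u n‖ + ‖v n‖)⁻¹ • u n with ha
  set b : ℕ → X := fun n => (‖u n‖ + ‖v n‖)⁻¹ • v n with hb
  have han : ∀ n, ‖a n‖ = (‖u n‖ + ‖v n‖)⁻¹ * ‖u n‖ := fun n => by
    rw [ha, norm_smul, Real.norm_of_nonneg (inv_nonneg.2 (hpos n).le)]
  have hbn : ∀ n, ‖b n‖ = (‖u n‖ + ‖v n‖)⁻¹ * ‖v n‖ := fun n => by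
    rw [hb, norm_smul, Real.norm_of_nonneg (inv_nonneg.2 (hpos n).le)]
  have hab : ∀ n, ‖a n‖ + ‖b n‖ = 1 := fun n => by
    rw [han, hbn, ← mul_add, inv_mul_cancel₀ (hpos n).ne']
  have habs : ∀ n, ‖a n + b n‖ ≤ 1 / ((n : ℝ) + 1) := fun n => by
    rw [ha, hb, ← smul_add, norm_smul, Real.norm_of_nonneg (inv_nonneg.2 (hpos n).le),
      inv_mul_le_iff₀ (hpos n), mul_comm]
    exact (huv n).le
  have hK : IsCompact (Metric.closedBall (0 : X) 1 ×ˢ Metric.closedBall (0 : X) 1) :=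
    (isCompact_closedBall _ _).prod (isCompact_closedBall _ _)
  obtain ⟨⟨a', b'⟩, -, phi, hphi, hlim⟩ := hK.tendsto_subseq (x := fun n => (a n, b n))
    (fun n => by
      have h1 := hab n
      have h2 := norm_nonneg (a n)
      have h3 := norm_nonneg (b n)
      simp only [Set.mem_prod, mem_closedBall_zero_iff]
      constructor <;> linarith)
  have hlima : Tendsto (a ∘ phi) atTop (𝓝 a') := (continuous_fst.tendsto _).comp hlim
  have hlimb : Tendsto (b ∘ phi) atTop (𝓝 b') := (continuous_snd.tendsto _).comp hlim
  have hone : Tendsto (fun n => 1 / (((phi n : ℕ) : ℝ) + 1)) atTop (𝓝 0) :=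
    tendsto_one_div_add_atTop_nhds_zero_nat.comp hphi.tendsto_atTop
  have hlimp : Tendsto (p ∘ phi) atTop (𝓝 w) :=
    tendsto_iff_norm_sub_tendsto_zero.2
      (squeeze_zero (fun _ => norm_nonneg _) (fun n => hp (phi n)) hone)
  have hlimq : Tendsto (q ∘ phi) atTop (𝓝 w) :=
    tendsto_iff_norm_sub_tendsto_zero.2
      (squeeze_zero (fun _ => norm_nonneg _) (fun n => hq (phi n)) hone)
  have hsum : a' + b' = 0 := by
    have h1 : Tendsto (fun n => ‖a (phi n) + b (phi n)‖) atTop (𝓝 0) :=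
      squeeze_zero (fun _ => norm_nonneg _) (fun n => habs (phi n)) hone
    exact norm_eq_zero.1 (tendsto_nhds_unique (hlima.add hlimb).norm h1)
  have hnorm : ‖a'‖ + ‖b'‖ = 1 := by
    refine tendsto_nhds_unique (hlima.norm.add hlimb.norm) ?_
    simp only [Function.comp_apply, hab]
    exact tendsto_const_nhds
  have hz := h ![a', b'] (fun i => by
    fin_cases i
    · exact ⟨p ∘ phi, a ∘ phi, hlimp, hlima, fun n => ⟨hpA _,
        smul_mem_proxNormalCone (hu _) (inv_nonneg.2 (hpos _).le)⟩⟩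
    · exact ⟨q ∘ phi, b ∘ phi, hlimq, hlimb, fun n => ⟨hqB _,
        smul_mem_proxNormalCone (hv _) (inv_nonneg.2 (hpos _).le)⟩⟩) (by simpa using hsum)
  have ha0 : a' = 0 := by simpa using hz 0
  have hb0 : b' = 0 := by simpa using hz 1
  rw [ha0, hb0] at hnorm
  norm_num at hnorm

theorem exists_mem_proj [FiniteDimensional ℝ X] {A : Set X} (hA : IsClosed A)
    (hne : A.Nonempty) (x : X) : ∃ p, p ∈ proj A x := by
  obtain ⟨p, hp, h⟩ := hA.exists_infDist_eq_dist hne x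
  exact ⟨p, hp, by rw [h, dist_eq_norm]⟩

theorem iInter_pair {E : Type*} (A B : Set E) : ⋂ i, (![A, B] : Fin 2 → Set E) i = A ∩ B := by
  ext x
  simp [Fin.forall_fin_two]

/-- Coercivity of the composition of two relaxed projectors, not both of them reflectors, for a
linearly regular pair. -/
theorem exists_mul_infDist_le_of_isLinearlyRegularAround [FiniteDimensional ℝ X] {A B : Set X}
    {w : X} {lam mu : ℝ} (hcA : IsClosed A) (hcB : IsClosed B) (hA : IsSuperregularAt A w)
    (hB : IsSuperregularAt B w) (hwA : w ∈ A) (hwB : w ∈ B) (hlam : 0 < lam ∧ lam ≤ 2)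
    (hmu : 0 < mu ∧ mu ≤ 2) (hlt : min lam mu < 2)
    (hreg : IsLinearlyRegularAround ![A, B] w) :
    ∃ nu > 0, ∃ delta > 0, ∀ x r z : X, ‖x - w‖ ≤ delta → r ∈ relaxedProj A lam x →
      z ∈ relaxedProj B mu r →
      nu * Metric.infDist x A ≤ ‖x - z‖ ∧ nu * Metric.infDist x B ≤ ‖x - z‖ := by
  obtain ⟨d0, hd0, kappa, hkappa, hreg⟩ := hreg
  have hne : (A ∩ B).Nonempty := ⟨w, hwA, hwB⟩
  have hl := hlam.1
  have hm := hmu.1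
  have hL : 0 ≤ (2 - lam) / lam := div_nonneg (by linarith [hlam.2]) hlam.1.le
  have hM : 0 ≤ (2 - mu) / mu := div_nonneg (by linarith [hmu.2]) hmu.1.le
  set tau := max ((2 - lam) / lam) ((2 - mu) / mu) with htau
  have htau0 : 0 < tau := by
    rcases min_lt_iff.1 hlt with h | h
    · exact lt_max_of_lt_left (div_pos (by linarith) hl)
    · exact lt_max_of_lt_right (div_pos (by linarith) hm)
  set K := 1 + 1 / mu + 1 / lam with hK
  have hK0 : 0 < K := by positivity
  -- The constant makes linear regularity yield the contradiction `d ≤ d / 2` at the end.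
  set sigma := 1 / (4 * kappa * K) with hsigma
  have hsigma0 : 0 < sigma := by positivity
  obtain ⟨nu, hnu, hnu1, hnus, hnut⟩ :
      ∃ nu : ℝ, 0 < nu ∧ nu ≤ 1 ∧ nu ≤ sigma ∧ 3 * nu ≤ sigma ^ 2 * tau :=
    ⟨min 1 (min sigma (sigma ^ 2 * tau / 3)), by positivity, min_le_left _ _,
      (min_le_right _ _).trans (min_le_left _ _),
      by linarith [(min_le_right 1 (min sigma (sigma ^ 2 * tau / 3))).trans (min_le_right _ _)]⟩
  obtain ⟨d1, hd1, H⟩ := exists_norm_relaxedProj_comp_sub_sq_le hA hB hwA hwB hlam hmu hnu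
  refine ⟨nu, hnu, min d0 d1, by positivity, fun x r z hx hr hz => ?_⟩
  obtain ⟨c, hc⟩ := exists_mem_proj (hcA.inter hcB) hne x
  have hcw : ‖c - w‖ ≤ 2 * d1 := by
    have h1 := norm_sub_le_of_mem_proj hc (show w ∈ A ∩ B from ⟨hwA, hwB⟩)
    have h2 := norm_sub_le_norm_sub_add_norm_sub c x w
    rw [norm_sub_rev c x] at h2
    linarith [min_le_right d0 d1]
  have h1 := H x r z (hx.trans (min_le_right _ _)) hr hz c hc.1 hcw
  have hlr := hreg x (by simpa [dist_eq_norm] using hx.trans (min_le_left _ _))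
  rw [iInter_pair, ← hc.2] at hlr
  obtain ⟨hdA, hdB⟩ := infDist_le_of_mem_relaxedProj hl hm hr hz
  set d := ‖x - c‖ with hd
  have hdA' : Metric.infDist x A ≤ d := by
    rw [hd, ← dist_eq_norm]
    exact Metric.infDist_le_dist_of_mem hc.1.1
  have hdB' : Metric.infDist x B ≤ d := by
    rw [hd, ← dist_eq_norm]
    exact Metric.infDist_le_dist_of_mem hc.1.2
  suffices hmain : nu * d ≤ ‖x - z‖ from
    ⟨(mul_le_mul_of_nonneg_left hdA' hnu.le).trans hmain,
      (mul_le_mul_of_nonneg_left hdB' hnu.le).trans hmain⟩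
  by_contra! hlt'
  have hdpos : 0 < d := by
    by_contra! h
    have := mul_nonpos_of_nonneg_of_nonpos hnu.le h
    linarith [norm_nonneg (x - z)]
  have h2 : (1 - nu) * d ≤ ‖z - c‖ := by
    have := norm_sub_le_norm_sub_add_norm_sub x z c
    linarith
  have h3 : ((1 - nu) * d) ^ 2 ≤ ‖z - c‖ ^ 2 :=
    pow_le_pow_left₀ (mul_nonneg (by linarith) hdpos.le) h2 2
  -- Uses `(1 + nu) - (1 - nu)² ≤ 3 * nu`.
  have h4 : (2 - lam) / lam * ‖x - r‖ ^ 2 + (2 - mu) / mu * ‖r - z‖ ^ 2 ≤ 3 * nu * d ^ 2 := by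
    nlinarith [mul_nonneg (sq_nonneg nu) (sq_nonneg d)]
  have h5 : 3 * nu * d ^ 2 ≤ tau * (sigma * d) ^ 2 := by
    nlinarith [mul_le_mul_of_nonneg_right hnut (sq_nonneg d)]
  -- Only the displacement carrying the larger coefficient `tau` is controlled, since the other
  -- coefficient may vanish; smallness of `x - z` then bounds the other displacement.
  have h6 : ‖x - r‖ ≤ sigma * d ∨ ‖r - z‖ ≤ sigma * d := by
    rcases max_choice ((2 - lam) / lam) ((2 - mu) / mu) with h | h
    · left
      rw [← h, ← htau] at h4
      refine le_of_sq_le_sq (le_of_mul_le_mul_left ?_ htau0) (by positivity)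
      linarith [mul_nonneg hM (sq_nonneg ‖r - z‖)]
    · right
      refine le_of_sq_le_sq (le_of_mul_le_mul_left ?_ htau0) (by positivity)
      rw [htau, h] at h5 ⊢
      linarith [mul_nonneg hL (sq_nonneg ‖x - r‖)]
  have hnd : nu * d ≤ sigma * d := mul_le_mul_of_nonneg_right hnus hdpos.le
  have h7 : ‖x - r‖ ≤ 2 * (sigma * d) ∧ ‖r - z‖ ≤ 2 * (sigma * d) := by
    have e1 := norm_sub_le_norm_sub_add_norm_sub x z r
    have e2 := norm_sub_le_norm_sub_add_norm_sub r x z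
    rw [norm_sub_rev z r] at e1
    rw [norm_sub_rev r x] at e2
    rcases h6 with h | h <;> constructor <;> linarith
  have h8 : Metric.infDist x A ≤ K * (2 * (sigma * d)) := by
    have e1 : ‖x - r‖ / lam ≤ 2 * (sigma * d) / lam := div_le_div_of_nonneg_right h7.1 hl.le
    have e2 : K * (2 * (sigma * d)) =
        2 * (sigma * d) / lam + (1 + 1 / mu) * (2 * (sigma * d)) := by rw [hK]; ring
    have e3 : 0 ≤ (1 + 1 / mu) * (2 * (sigma * d)) := by positivity
    linarith
  have h9 : Metric.infDist x B ≤ K * (2 * (sigma * d)) := by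
    have e1 : ‖r - z‖ / mu ≤ 2 * (sigma * d) / mu := div_le_div_of_nonneg_right h7.2 hm.le
    have e2 : K * (2 * (sigma * d)) =
        2 * (sigma * d) + 2 * (sigma * d) / mu + 1 / lam * (2 * (sigma * d)) := by rw [hK]; ring
    have e3 : 0 ≤ 1 / lam * (2 * (sigma * d)) := by positivity
    linarith [h7.1]
  have h10 : ⨆ i, Metric.infDist x ((![A, B] : Fin 2 → Set X) i) ≤ K * (2 * (sigma * d)) :=
    ciSup_le fun i => by
      fin_cases i
      · exact h8
      · exact h9
  have h11 := hlr.trans (mul_le_mul_of_nonneg_left h10 hkappa.le)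
  have h12 : kappa * (K * (2 * (sigma * d))) = d / 2 := by
    rw [hsigma]
    field_simp
    norm_num
  linarith

/-- Coercivity of the composition of two reflectors for a strongly regular pair. -/
theorem IsStronglyRegularAt.exists_mul_infDist_le [FiniteDimensional ℝ X] {A B : Set X} {w : X}
    (hwA : w ∈ A) (hwB : w ∈ B) (h : IsStronglyRegularAt ![A, B] w) :
    ∃ nu > 0, ∃ delta > 0, ∀ x r z : X, ‖x - w‖ ≤ delta → r ∈ relaxedProj A 2 x →
      z ∈ relaxedProj B 2 r →
      nu * Metric.infDist x A ≤ ‖x - z‖ ∧ nu * Metric.infDist x B ≤ ‖x - z‖ := by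
  obtain ⟨nu, hnu, d, hd, H⟩ := h.exists_mul_le_norm_add
  refine ⟨nu, hnu, d / 6, by positivity, ?_⟩
  rintro x r z hx hr hz
  have hxr := norm_sub_eq_of_mem_relaxedProj two_pos hr
  obtain ⟨hdA, hdB⟩ := infDist_le_of_mem_relaxedProj two_pos two_pos hr hz
  obtain ⟨p, hp, hpr⟩ := hr
  obtain ⟨q, hq, hqz⟩ := hz
  have ea : x - r = (2 : ℝ) • (x - p) := by rw [hpr]; module
  have eb : r - z = (2 : ℝ) • (r - q) := by rw [hqz]; module
  have hpw : ‖x - p‖ ≤ ‖x - w‖ := norm_sub_le_of_mem_proj hp hwA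
  have hqw : ‖r - q‖ ≤ ‖r - w‖ := norm_sub_le_of_mem_proj hq hwB
  have hxr' : ‖x - r‖ = 2 * ‖x - p‖ := by
    rw [ea, norm_smul, Real.norm_of_nonneg zero_le_two]
  have e1 := norm_sub_le_norm_sub_add_norm_sub p x w
  have e2 := norm_sub_le_norm_sub_add_norm_sub r x w
  have e3 := norm_sub_le_norm_sub_add_norm_sub q r w
  rw [norm_sub_rev p x] at e1
  rw [norm_sub_rev r x] at e2
  rw [norm_sub_rev q r] at e3
  have h1 := H p hp.1 q hq.1 (by linarith) (by linarith) (x - r)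
    ⟨x, 2, hp, zero_le_two, ea⟩ (r - z) ⟨r, 2, hq, zero_le_two, eb⟩
  rw [sub_add_sub_cancel] at h1
  have n1 := norm_nonneg (x - r)
  have n2 := norm_nonneg (r - z)
  constructor <;> refine le_trans (mul_le_mul_of_nonneg_left ?_ hnu.le) h1 <;> linarith

/-- Near a point of superregularity, generalized Douglas-Rachford operators are quasi firmly Fejér
monotone and coercive, under linear (or strong) regularity of the pair. -/
theorem exists_gDR_fejer_coercive [FiniteDimensional ℝ X] {A B : Set X}
    {w : X} {lam mu alpha : ℝ} (hcA : IsClosed A) (hcB : IsClosed B) (hA : IsSuperregularAt A w)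
    (hB : IsSuperregularAt B w) (hwA : w ∈ A) (hwB : w ∈ B) (hlam : 0 < lam ∧ lam ≤ 2)
    (hmu : 0 < mu ∧ mu ≤ 2) (halpha : 0 < alpha ∧ alpha < 1 + betaHat lam mu)
    (hlin : min lam mu < 2 → IsLinearlyRegularAround ![A, B] w)
    (hstrong : ¬ min lam mu < 2 → IsStronglyRegularAt ![A, B] w) :
    ∃ eta > 0, ∃ nu > 0, ∀ eps > 0, ∃ delta > 0, ∀ x y : X, ‖x - w‖ ≤ delta →
      y ∈ gDR A B lam mu alpha x →
      (∀ c ∈ A ∩ B, ‖c - w‖ ≤ 2 * delta →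
        ‖y - c‖ ^ 2 ≤ (1 + eps) * ‖x - c‖ ^ 2 - eta * ‖x - y‖ ^ 2) ∧
      nu * Metric.infDist x A ≤ ‖x - y‖ ∧ nu * Metric.infDist x B ≤ ‖x - y‖ := by
  have hcoer : ∃ nu > 0, ∃ delta > 0, ∀ x r z : X, ‖x - w‖ ≤ delta → r ∈ relaxedProj A lam x →
      z ∈ relaxedProj B mu r →
      nu * Metric.infDist x A ≤ ‖x - z‖ ∧ nu * Metric.infDist x B ≤ ‖x - z‖ := by
    by_cases hlt : min lam mu < 2
    · exact exists_mul_infDist_le_of_isLinearlyRegularAround hcA hcB hA hB hwA hwB hlam hmu hlt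
        (hlin hlt)
    · obtain ⟨h1, h2⟩ := le_min_iff.1 (not_lt.1 hlt)
      obtain rfl : lam = 2 := le_antisymm hlam.2 h1
      obtain rfl : mu = 2 := le_antisymm hmu.2 h2
      exact (hstrong hlt).exists_mul_infDist_le hwA hwB
  obtain ⟨nu, hnu, d1, hd1, H1⟩ := hcoer
  refine ⟨(1 + betaHat lam mu - alpha) / alpha, div_pos (by linarith [halpha.2]) halpha.1,
    alpha * nu, mul_pos halpha.1 hnu, fun eps heps => ?_⟩
  obtain ⟨d2, hd2, H2⟩ := exists_norm_gDR_sub_sq_le hA hB hwA hwB hlam hmu halpha.1 heps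
  refine ⟨min d1 d2, by positivity, fun x y hx hy => ⟨fun c hc hcw => ?_, ?_⟩⟩
  · exact H2 x y (hx.trans (min_le_right _ _)) hy c hc (by linarith [min_le_right d1 d2])
  · obtain ⟨r, hr, z, hz, rfl⟩ := hy
    have h1 := H1 x r z (hx.trans (min_le_left _ _)) hr hz
    have hxy : x - ((1 - alpha) • x + alpha • z) = alpha • (x - z) := by module
    rw [hxy, norm_smul, Real.norm_of_nonneg halpha.1.le, mul_assoc, mul_assoc]
    exact ⟨mul_le_mul_of_nonneg_left h1.1 halpha.1.le,
      mul_le_mul_of_nonneg_left h1.2 halpha.1.le⟩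

end Step

/-! ### From single steps to cycles and R-linear convergence -/

section Cycle

variable {X : Type*} [NormedAddCommGroup X] [InnerProductSpace ℝ X]

theorem exists_pos_forall_le_of_antitone {ι : Type*} [Finite ι] {P : ι → ℝ → Prop}
    (hP : ∀ i a b, 0 < a → a ≤ b → P i b → P i a) (h : ∀ i, ∃ a > 0, P i a) :
    ∃ a > 0, ∀ i, P i a := by
  cases nonempty_fintype ι
  choose f hf hPf using h
  rcases isEmpty_or_nonempty ι with hι | hι
  · exact ⟨1, one_pos, fun i => (hι.false i).elim⟩
  · obtain ⟨i0, h0⟩ := Finite.exists_min f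
    exact ⟨f i0, hf i0, fun i => hP i _ _ (hf i0) (h0 i) (hPf i)⟩

/-- A full cycle reduces the distance to the intersection by a constant factor. -/
theorem exists_cycle_contraction [FiniteDimensional ℝ X] {m l : ℕ} (hm : 0 < m)
    (C : Fin m → Set X) (hC : ∀ i, IsClosed (C i)) {w : X} (hw : w ∈ ⋂ i, C i)
    (hlin : IsLinearlyRegularAround C w) (T : Fin l → X → Set X) (S : Fin l → Set (Fin m))
    (hS : ∀ i, ∃ j, i ∈ S j) {eta nu : ℝ} (heta : 0 < eta) (hnu : 0 < nu)
    (hT : ∀ eps > 0, ∃ delta > 0, ∀ j, ∀ x y : X, ‖x - w‖ ≤ delta → y ∈ T j x →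
      (∀ c ∈ ⋂ i, C i, ‖c - w‖ ≤ 2 * delta →
        ‖y - c‖ ^ 2 ≤ (1 + eps) * ‖x - c‖ ^ 2 - eta * ‖x - y‖ ^ 2) ∧
      ∀ i ∈ S j, nu * Metric.infDist x (C i) ≤ ‖x - y‖) :
    ∃ theta : ℝ, 0 < theta ∧ theta < 1 ∧ ∃ M > 0, ∃ delta > 0, ∀ y : ℕ → X,
      ‖y 0 - w‖ ≤ delta → (∀ k (hk : k < l), y (k + 1) ∈ T ⟨k, hk⟩ (y k)) →
      (∀ k ≤ l, ‖y k - y 0‖ ≤ M * Metric.infDist (y 0) (⋂ i, C i)) ∧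
      Metric.infDist (y l) (⋂ i, C i) ≤ theta * Metric.infDist (y 0) (⋂ i, C i) := by
  obtain ⟨d0, hd0, kappa, hkappa, hreg⟩ := hlin
  set K := (kappa * (l + nu⁻¹)) ^ 2 with hK
  have hK0 : 0 < K := by positivity
  have hgap : 0 < eta / (2 * K) := by positivity
  -- The bound 3 makes each step at most double the distance to `c`; the second bound lets the
  -- factor `(1 + eps) ^ l` consume only half of the gain `eta / K`.
  obtain ⟨eps, heps, heps3, hepsl⟩ :
      ∃ eps : ℝ, 0 < eps ∧ eps ≤ 3 ∧ (1 + eps) ^ l ≤ 1 + eta / (2 * K) := by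
    have hcont : Tendsto (fun e : ℝ => (1 + e) ^ l) (𝓝[>] 0) (𝓝 1) := by
      have : Continuous fun e : ℝ => (1 + e) ^ l := by fun_prop
      simpa using (this.tendsto 0).mono_left nhdsWithin_le_nhds
    have h1 : ∀ᶠ e : ℝ in 𝓝[>] 0, (1 + e) ^ l < 1 + eta / (2 * K) :=
      hcont.eventually (gt_mem_nhds (by linarith))
    have h2 : ∀ᶠ e : ℝ in 𝓝[>] 0, e ∈ Set.Ioo (0 : ℝ) 3 := Ioo_mem_nhdsGT (by norm_num)
    obtain ⟨e, h1, h2⟩ := (h1.and h2).exists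
    exact ⟨e, h2.1, h2.2.le, h1.le⟩
  obtain ⟨d1, hd1, H⟩ := hT eps heps
  -- The `1 / 4` only keeps the rate positive.
  set q := max (1 - eta / (2 * K)) (1 / 4) with hq
  have hq0 : 0 < q := lt_max_of_lt_right (by norm_num)
  have hq1 : q < 1 := max_lt (by linarith) (by norm_num)
  set M : ℝ := 2 ^ l + 2 with hM
  have hM0 : 2 ≤ M := by rw [hM]; linarith [pow_pos (two_pos (α := ℝ)) l]
  refine ⟨√q, Real.sqrt_pos.2 hq0, by rw [Real.sqrt_lt' one_pos]; simpa using hq1, M,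
    by linarith, min d0 (d1 / M), by positivity, fun y hy0 hy => ?_⟩
  have hclosed : IsClosed (⋂ i, C i) := isClosed_iInter hC
  have hy0' : ‖y 0 - w‖ ≤ d1 / M := hy0.trans (min_le_right _ _)
  have hy0M : M * ‖y 0 - w‖ ≤ d1 := by
    rw [le_div_iff₀ (by linarith)] at hy0'
    linarith
  obtain ⟨c, hc⟩ := exists_mem_proj hclosed ⟨w, hw⟩ (y 0)
  have hcy := norm_sub_le_of_mem_proj hc hw
  have n0 := norm_nonneg (y 0 - w)
  have hcw : ‖c - w‖ ≤ 2 * d1 := by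
    have h2 := norm_sub_le_norm_sub_add_norm_sub c (y 0) w
    rw [norm_sub_rev c (y 0)] at h2
    nlinarith
  rw [← hc.2]
  set d := ‖y 0 - c‖ with hd
  have hd_nonneg : 0 ≤ d := norm_nonneg _
  have hpow : ∀ k ≤ l, (2 : ℝ) ^ k ≤ 2 ^ l := fun k hk => pow_le_pow_right₀ one_le_two hk
  have hnear : ∀ k ≤ l, ‖y k - c‖ ≤ 2 ^ k * d → ‖y k - y 0‖ ≤ M * d ∧ ‖y k - w‖ ≤ d1 := by
    intro k hk h1
    have h2 : (2 : ℝ) ^ k * d ≤ 2 ^ l * d := mul_le_mul_of_nonneg_right (hpow k hk) hd_nonneg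
    have h3 := norm_sub_le_norm_sub_add_norm_sub (y k) c (y 0)
    have h4 := norm_sub_le_norm_sub_add_norm_sub (y k) (y 0) w
    rw [norm_sub_rev c (y 0)] at h3
    have h5 : (2 : ℝ) ^ l * d ≤ 2 ^ l * ‖y 0 - w‖ := by gcongr
    constructor
    · rw [hM]
      linarith
    · rw [hM] at hy0M
      linarith
  have hbound : ∀ k ≤ l, ‖y k - c‖ ≤ 2 ^ k * d := by
    intro k
    induction k with
    | zero => intro _; simp [hd]
    | succ k ih =>
      intro hk
      have h1 := ih (by omega)
      have h2 := (H ⟨k, hk⟩ (y k) (y (k + 1)) (hnear k (by omega) h1).2 (hy k hk)).1 c hc.1 hcw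
      refine le_of_sq_le_sq ?_ (by positivity)
      have h3 : ‖y k - c‖ ^ 2 ≤ (2 ^ k * d) ^ 2 := by gcongr
      have h4 : eps * ‖y k - c‖ ^ 2 ≤ 3 * ‖y k - c‖ ^ 2 := by gcongr
      have h5 : ((2 : ℝ) ^ (k + 1) * d) ^ 2 = 4 * (2 ^ k * d) ^ 2 := by ring
      have h6 : 0 ≤ eta * ‖y k - y (k + 1)‖ ^ 2 := by positivity
      linarith
  refine ⟨fun k hk => (hnear k hk (hbound k hk)).1, ?_⟩
  have hstep : ∀ k (hk : k < l), _ := fun k hk =>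
    H ⟨k, hk⟩ (y k) (y (k + 1)) (hnear k hk.le (hbound k hk.le)).2 (hy k hk)
  have hsum : ∀ k ≤ l, ‖y k - c‖ ^ 2 + eta * ∑ i ∈ Finset.range k, ‖y i - y (i + 1)‖ ^ 2
      ≤ (1 + eps) ^ k * d ^ 2 := by
    intro k
    induction k with
    | zero => intro _; simp [hd]
    | succ k ih =>
      intro hk
      have h1 := ih (by omega)
      have h2 := (hstep k hk).1 c hc.1 hcw
      rw [Finset.sum_range_succ, mul_add]
      have h3 : 0 ≤ eps * (eta * ∑ i ∈ Finset.range k, ‖y i - y (i + 1)‖ ^ 2) := by positivity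
      have h4 := mul_le_mul_of_nonneg_left h1 (show 0 ≤ 1 + eps by linarith)
      rw [pow_succ' (1 + eps)]
      linarith
  set Q := ∑ i ∈ Finset.range l, ‖y i - y (i + 1)‖ ^ 2 with hQ
  have hle : ∀ k < l, ‖y k - y (k + 1)‖ ≤ √Q := fun k hk =>
    Real.le_sqrt_of_sq_le (Finset.single_le_sum (f := fun i => ‖y i - y (i + 1)‖ ^ 2)
      (fun _ _ => sq_nonneg _) (Finset.mem_range.2 hk))
  have hpath : ∀ k ≤ l, ‖y 0 - y k‖ ≤ k * √Q := by
    intro k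
    induction k with
    | zero => intro _; simp
    | succ k ih =>
      intro hk
      have h1 := norm_sub_le_norm_sub_add_norm_sub (y 0) (y k) (y (k + 1))
      push_cast
      linarith [ih (by omega), hle k hk]
  -- Coercivity bounds the distance to `C i` at the step `j` that uses it; the path from `y 0` to `y
  -- j` adds at most `l * √Q`.
  have hdist : ∀ i, Metric.infDist (y 0) (C i) ≤ (l + nu⁻¹) * √Q := by
    intro i
    obtain ⟨j, hj⟩ := hS i
    have h1 := (hstep j j.2).2 i hj
    have h2 : Metric.infDist (y j) (C i) ≤ nu⁻¹ * √Q := by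
      rw [← div_eq_inv_mul, le_div_iff₀ hnu, mul_comm]
      exact h1.trans (hle j j.2)
    have h3 : Metric.infDist (y 0) (C i) ≤ Metric.infDist (y j) (C i) + dist (y 0) (y j) :=
      Metric.infDist_le_infDist_add_dist
    rw [dist_eq_norm] at h3
    have h4 : ((j : ℕ) : ℝ) * √Q ≤ l * √Q := by
      gcongr
      exact j.2.le
    linarith [hpath j j.2.le]
  have hdQ : d ^ 2 ≤ K * Q := by
    have : Nonempty (Fin m) := ⟨⟨0, hm⟩⟩
    have h1 := hreg (y 0) (by simpa [dist_eq_norm] using hy0.trans (min_le_left _ _))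
    rw [← hc.2] at h1
    have h2 : d ≤ kappa * ((l + nu⁻¹) * √Q) :=
      h1.trans (mul_le_mul_of_nonneg_left (ciSup_le hdist) hkappa.le)
    have h3 : d ^ 2 ≤ (kappa * ((l + nu⁻¹) * √Q)) ^ 2 := by gcongr
    have h4 : (kappa * ((l + nu⁻¹) * √Q)) ^ 2 = K * (√Q) ^ 2 := by rw [hK]; ring
    rwa [h4, Real.sq_sqrt (Finset.sum_nonneg fun _ _ => sq_nonneg _)] at h3
  have hfin : ‖y l - c‖ ^ 2 ≤ q * d ^ 2 := by
    have h1 := hsum l le_rfl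
    have h2 : (1 + eps) ^ l * d ^ 2 ≤ (1 + eta / (2 * K)) * d ^ 2 := by gcongr
    have h3 : eta / K * d ^ 2 ≤ eta * Q := by
      rw [div_mul_eq_mul_div, div_le_iff₀ hK0]
      nlinarith
    have h4 : (1 - eta / (2 * K)) * d ^ 2 ≤ q * d ^ 2 :=
      mul_le_mul_of_nonneg_right (le_max_left _ _) (sq_nonneg d)
    have h5 : eta / K = 2 * (eta / (2 * K)) := by field_simp
    rw [h5] at h3
    linarith
  have h1 : Metric.infDist (y l) (⋂ i, C i) ≤ ‖y l - c‖ := by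
    rw [← dist_eq_norm]
    exact Metric.infDist_le_dist_of_mem hc.1
  refine h1.trans (le_of_sq_le_sq ?_ (by positivity))
  rwa [mul_pow, Real.sq_sqrt hq0.le]

/-- Uniform contraction of the distance to a closed set along blocks of length `l` yields R-linear
convergence. -/
theorem exists_convergesRLinearly_of_cycle_contraction [FiniteDimensional ℝ X] {l : ℕ} (hl : 0 < l)
    {D : Set X} (hD : IsClosed D) {w : X} (hw : w ∈ D) {theta M delta : ℝ} (htheta : 0 < theta)
    (htheta1 : theta < 1) (hM : 0 < M) (hdelta : 0 < delta) :
    ∃ rho : ℝ, 0 ≤ rho ∧ rho < 1 ∧ ∃ r : ℝ, 0 < r ∧ ∀ x : ℕ → X, ‖x 0 - w‖ ≤ r →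
      (∀ n, ‖x (l * n) - w‖ ≤ delta →
        (∀ k ≤ l, ‖x (l * n + k) - x (l * n)‖ ≤ M * Metric.infDist (x (l * n)) D) ∧
        Metric.infDist (x (l * n + l)) D ≤ theta * Metric.infDist (x (l * n)) D) →
      ∃ xbar ∈ D, ConvergesRLinearly x xbar rho := by
  have h1t : 0 < 1 - theta := by linarith
  obtain ⟨rho, hrho, hrho1, hrhol⟩ : ∃ rho : ℝ, 0 < rho ∧ rho < 1 ∧ rho ^ l = theta :=
    ⟨theta ^ ((l : ℝ)⁻¹), Real.rpow_pos_of_pos htheta _,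
      Real.rpow_lt_one htheta.le htheta1 (by positivity),
      Real.rpow_inv_natCast_pow htheta.le hl.ne'⟩
  -- Chosen so that the initial distance plus the geometric series of block displacements totals
  -- `delta`.
  set r := delta / (1 + M / (1 - theta)) with hr
  have hr0 : 0 < r := by positivity
  have hrd : r + M * r / (1 - theta) = delta := by
    rw [hr]
    field_simp
  refine ⟨rho, hrho.le, hrho1, r, hr0, fun x hx0 H => ?_⟩
  have hd0 : Metric.infDist (x 0) D ≤ r := by
    refine le_trans ?_ hx0
    rw [← dist_eq_norm]
    exact Metric.infDist_le_dist_of_mem hw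
  have hind : ∀ n, Metric.infDist (x (l * n)) D ≤ theta ^ n * r ∧
      ‖x (l * n) - w‖ ≤ r + M * r / (1 - theta) * (1 - theta ^ n) := by
    intro n
    induction n with
    | zero => simpa using ⟨hd0, hx0⟩
    | succ n ih =>
      obtain ⟨h1, h2⟩ := ih
      have h3 : ‖x (l * n) - w‖ ≤ delta := by
        have : 0 ≤ M * r / (1 - theta) * theta ^ n := by positivity
        linarith
      obtain ⟨h4, h5⟩ := H n h3
      rw [mul_add_one]
      constructor
      · rw [pow_succ']
        have := mul_le_mul_of_nonneg_left h1 htheta.le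
        linarith
      · have h6 := h4 l le_rfl
        have h7 := norm_sub_le_norm_sub_add_norm_sub (x (l * n + l)) (x (l * n)) w
        have h8 : M * Metric.infDist (x (l * n)) D ≤ M * (theta ^ n * r) := by gcongr
        have h9 : M * r / (1 - theta) * (1 - theta ^ (n + 1)) =
            M * r / (1 - theta) * (1 - theta ^ n) + M * (theta ^ n * r) := by
          field_simp
          ring
        linarith
  have hblock : ∀ n, ∀ k ≤ l, dist (x (l * n)) (x (l * n + k)) ≤ M * r * theta ^ n := by
    intro n k hk
    have h3 : ‖x (l * n) - w‖ ≤ delta := by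
      have : 0 ≤ M * r / (1 - theta) * theta ^ n := by positivity
      linarith [(hind n).2]
    rw [dist_comm, dist_eq_norm]
    have h8 : M * Metric.infDist (x (l * n)) D ≤ M * (theta ^ n * r) := by
      gcongr
      exact (hind n).1
    linarith [(H n h3).1 k hk]
  have hstep : ∀ n, dist (x (l * n)) (x (l * (n + 1))) ≤ M * r * theta ^ n :=
    fun n => hblock n l le_rfl
  obtain ⟨xbar, hlim⟩ := cauchySeq_tendsto_of_complete
    (cauchySeq_of_le_geometric (f := fun n => x (l * n)) theta (M * r) htheta1 hstep)
  have hxbar : xbar ∈ D := by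
    rw [hD.mem_iff_infDist_zero ⟨w, hw⟩]
    have h1 : Tendsto (fun n => Metric.infDist (x (l * n)) D) atTop (𝓝 (Metric.infDist xbar D)) :=
      ((Metric.continuous_infDist_pt D).tendsto xbar).comp hlim
    have h2 : Tendsto (fun n => theta ^ n * r) atTop (𝓝 0) := by
      simpa using (tendsto_pow_atTop_nhds_zero_of_lt_one htheta.le htheta1).mul_const r
    exact tendsto_nhds_unique h1
      (squeeze_zero (fun _ => Metric.infDist_nonneg) (fun n => (hind n).1) h2)
  refine ⟨xbar, hxbar, hrho.le, hrho1, (M * r + M * r / (1 - theta)) / theta, by positivity,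
    fun n => ?_⟩
  have h1 := hblock (n / l) (n % l) (Nat.mod_lt n hl).le
  rw [Nat.div_add_mod] at h1
  have h2 := dist_le_of_le_geometric_of_tendsto theta (M * r) htheta1 hstep hlim (n / l)
  -- Rounding `n` down to a multiple of `l` costs at most one factor `theta = rho ^ l`.
  have h3 : theta ^ (n / l) ≤ rho ^ n / theta := by
    rw [le_div_iff₀ htheta, ← pow_succ, ← hrhol, ← pow_mul]
    refine pow_le_pow_of_le_one hrho.le hrho1.le ?_
    rw [mul_add_one]
    exact (Nat.lt_mul_div_succ n hl).le
  have h4 := dist_triangle_left (x n) xbar (x (l * (n / l)))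
  rw [← dist_eq_norm]
  calc dist (x n) xbar
      ≤ (M * r + M * r / (1 - theta)) * theta ^ (n / l) := by
        have : M * r * theta ^ (n / l) / (1 - theta) = M * r / (1 - theta) * theta ^ (n / l) := by
          ring
        linarith
    _ ≤ (M * r + M * r / (1 - theta)) * (rho ^ n / theta) := by gcongr
    _ = (M * r + M * r / (1 - theta)) / theta * rho ^ n := by ring

end Cycle

end GDR

theorem corollary5p10 {X : Type*} [NormedAddCommGroup X] [InnerProductSpace ℝ X]
    [FiniteDimensional ℝ X] {m l : ℕ} (hm : 0 < m) (hl : 0 < l)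
    (C : Fin m → Set X) (hC : ∀ i, IsClosed (C i))
    (s t : Fin l → Fin m) (hst : ∀ j, s j ≠ t j)
    (hcover : Set.range s ∪ Set.range t = Set.univ)
    (lam mu alpha : Fin l → ℝ)
    (hlam : ∀ j, 0 < lam j ∧ lam j ≤ 2) (hmu : ∀ j, 0 < mu j ∧ mu j ≤ 2)
    (halpha : ∀ j, 0 < alpha j ∧ alpha j < 1 + GDR.betaHat (lam j) (mu j))
    (w : X) (hw : w ∈ ⋂ i, C i)
    (hsuper : ∀ i, GDR.IsSuperregularAt (C i) w)
    (hlin : GDR.IsLinearlyRegularAround C w)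
    (hpair_lin : ∀ j, min (lam j) (mu j) < 2 →
      GDR.IsLinearlyRegularAround ![C (s j), C (t j)] w)
    (hpair_strong : ∀ j, ¬ min (lam j) (mu j) < 2 →
      GDR.IsStronglyRegularAt ![C (s j), C (t j)] w) :
    ∃ rho : ℝ, 0 ≤ rho ∧ rho < 1 ∧ ∃ r : ℝ, 0 < r ∧
      ∀ x : ℕ → X, x 0 ∈ Metric.closedBall w r →
        GDR.IsCyclicSequence hl
          (fun j => GDR.gDR (C (s j)) (C (t j)) (lam j) (mu j) (alpha j)) x →
        ∃ xbar ∈ ⋂ i, C i, GDR.ConvergesRLinearly x xbar rho := by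
  have hwi : ∀ i, w ∈ C i := Set.mem_iInter.1 hw
  have : Nonempty (Fin l) := ⟨⟨0, hl⟩⟩
  choose eta heta nu hnu H using fun j =>
    GDR.exists_gDR_fejer_coercive (hC (s j)) (hC (t j)) (hsuper (s j)) (hsuper (t j)) (hwi (s j))
      (hwi (t j)) (hlam j) (hmu j) (halpha j) (hpair_lin j) (hpair_strong j)
  obtain ⟨eta', heta', hetale⟩ := GDR.exists_pos_forall_le_of_antitone
    (P := fun j a => a ≤ eta j) (fun _ _ _ _ h h' => h.trans h')
    (fun j => ⟨eta j, heta j, le_rfl⟩)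
  obtain ⟨nu', hnu', hnule⟩ := GDR.exists_pos_forall_le_of_antitone
    (P := fun j a => a ≤ nu j) (fun _ _ _ _ h h' => h.trans h')
    (fun j => ⟨nu j, hnu j, le_rfl⟩)
  obtain ⟨theta, htheta, htheta1, M, hM, delta, hdelta, hcycle⟩ :=
    GDR.exists_cycle_contraction hm C hC hw hlin
      (fun j => GDR.gDR (C (s j)) (C (t j)) (lam j) (mu j) (alpha j)) (fun j => {s j, t j})
      (fun i => by
        have hi : i ∈ Set.range s ∪ Set.range t := hcover ▸ Set.mem_univ i
        rcases hi with ⟨j, rfl⟩ | ⟨j, rfl⟩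
        · exact ⟨j, Or.inl rfl⟩
        · exact ⟨j, Or.inr rfl⟩)
      heta' hnu'
      (fun eps heps => by
        -- Shrinking `delta` restricts both `x` and `c`, so one radius serves all operators.
        refine GDR.exists_pos_forall_le_of_antitone ?_ fun j => ?_
        · intro j a b _ hab h x y hx hy
          obtain ⟨h1, h2⟩ := h x y (hx.trans hab) hy
          exact ⟨fun c hc hcw => h1 c hc (by linarith), h2⟩
        · obtain ⟨d, hd, h⟩ := H j eps heps
          refine ⟨d, hd, fun x y hx hy => ?_⟩
          obtain ⟨h1, h2, h3⟩ := h x y hx hy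
          refine ⟨fun c hc hcw => ?_, ?_⟩
          · have h4 := h1 c ⟨Set.mem_iInter.1 hc _, Set.mem_iInter.1 hc _⟩ hcw
            have h5 := mul_le_mul_of_nonneg_right (hetale j) (sq_nonneg ‖x - y‖)
            linarith
          · rintro i (rfl | rfl)
            · exact (mul_le_mul_of_nonneg_right (hnule j) Metric.infDist_nonneg).trans h2
            · exact (mul_le_mul_of_nonneg_right (hnule j) Metric.infDist_nonneg).trans h3)
  obtain ⟨rho, hrho, hrho1, r, hr, hconv⟩ :=
    GDR.exists_convergesRLinearly_of_cycle_contraction hl (isClosed_iInter hC) hw htheta htheta1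
      hM hdelta
  refine ⟨rho, hrho, hrho1, r, hr, fun x hx0 hx => hconv x (by simpa [dist_eq_norm] using hx0)
    fun n hn => hcycle (fun k => x (l * n + k)) hn fun k hk => ?_⟩
  have h := hx (l * n + k)
  have hmod : (⟨(l * n + k) % l, Nat.mod_lt _ hl⟩ : Fin l) = ⟨k, hk⟩ :=
    Fin.ext (by simp [Nat.mod_eq_of_lt hk])
  rw [hmod] at h
  exact h
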